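/- Consider a queue with $s$ parallel unit-rate exponential servers and Poisson arrivals of rate $\lambda=s-\gamma\sqrt s$, where $\gamma\in\mathbb R$ is fixed. An arrival finding $k$ customers is admitted if $k<s$, and is admitted with probability $p_s(k-s)\in[0,1]$ if $k\ge s$. Let $Q_s$ be the resulting birth–death process of the number in system: in state $k$ the birth rate is $\lambda$ if $k<s$ and $\lambda p_s(k-s)$ if $k\ge s$, and the death rate is $\min(k,s)$. Let $\pi_s$ be its stationary distribution (a probability vector satisfying the balance equations of $Q_s$) and, for a revenue structure $r_s(k)\in\mathbb R$, let $$R_s=\sum_{k\ge0} r_s(k)\,\pi_s(k).$$ Let $n_s\in\mathbb R$, $q_s\ne0$, and let $r:\mathbb R\to\mathbb R$ be such that $r$ is twice continuously differentiable, with $r,r',r''$ bounded, on each of $(-\infty,0]$ and $[0,\infty)$ (one-sided derivatives at $0$; so $r$ is continuous but may have a kink at $0$). Assume the revenue scaling $$\sup_{k\ge0}\Bigl|\frac{r_s(k)-n_s}{q_s}-r\Bigl(\frac{k-s}{\sqrt s}\Bigr)\Bigr|\to0\qquad(s\to\infty).$$ Say that the controls have admission profile $f:[0,\infty)\to\mathbb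 R$ if, for a fixed $\delta\in\{0,1\}$ (two index conventions), for all $s\ge1$ and $m\ge0$, $$p_s(0)p_s(1)\cdots p_s(m)=f\Bigl(\frac{m+\delta}{\sqrt s}\Bigr).$$ Let $\phi,\Phi$ be the standard normal density and distribution function, and put $$R(f)=\frac{\int_{-\infty}^0 r(x)e^{-x^2/2-\gamma x}\,dx+\int_0^\infty r(x)f(x)e^{-\gamma x}\,dx}{\frac{\Phi(\gamma)}{\phi(\gamma)}+\int_0^\infty f(x)e^{-\gamma x}\,dx}.$$ (i) Suppose that $f$ is twice continuously differentiable on $[0,\infty)$, that for $i=0,1,2$ there is $c>0$ with $\frac{d^i}{dx^i}\bigl(f(x)e^{-\gamma x}\bigr)=O(e^{-cx})$ as $x\to\infty$, and that the controls have admission profile $f$. Then the integrals in $R(f)$ converge absolutely; for all large $s$, $\pi_s$ exists and is unique and the series $R_s$ converges absolutely; and $$\lim_{s\to\infty}\frac{R_s-n_s}{q_s}=R(f).$$ (ii) Let $0\le\eta<\infty$ and $f=\mathbf 1_{[0,\eta)}$. Then $R(f)=R_T(\eta)$, where $$R_T(\eta)=\frac{\int_{-\infty}^0 r(x)e^{-x^2/2-\gamma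 x}\,dx+\int_0^\eta r(x)e^{-\gamma x}\,dx}{\frac{\Phi(\gamma)}{\phi(\gamma)}+\frac{1-e^{-\gamma\eta}}{\gamma}},$$ and $(1-e^{-\gamma\eta})/\gamma$ is read as $\eta$ when $\gamma=0$. If the controls have admission profile $f$, or if they are the threshold controls $p_s(m)=\mathbf 1\{m\le\lfloor\eta\sqrt s\rfloor\}$, then for all large $s$, $\pi_s$ exists and is unique and $R_s$ converges absolutely; and $$\lim_{s\to\infty}\frac{R_s-n_s}{q_s}=R_T(\eta).$$ -/

import Mathlib

open Set Filter Topology MeasureTheory ProbabilityTheory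

noncomputable section

/-- Arrival rate into the system with `s` servers in state `k`: everybody is admitted while a server
is free, and with probability `p (k - s)` when `k ≥ s`. -/
def arrivalRate (s : ℕ) (lam : ℝ) (p : ℕ → ℝ) (k : ℕ) : ℝ :=
  if k < s then lam else lam * p (k - s)

/-- Total service rate in state `k` (unit-rate servers). -/
def serviceRate (s : ℕ) (k : ℕ) : ℝ := ((min k s : ℕ) : ℝ)

/-- The generator of the number-in-system process `Q_s`. -/
def generator (s : ℕ) (lam : ℝ) (p : ℕ → ℝ) (i j : ℕ) : ℝ :=
  if j = i + 1 then arrivalRate s lam p i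
  else if i = j + 1 then serviceRate s i
  else if i = j then -(arrivalRate s lam p i + serviceRate s i)
  else 0

/-- `π` is a stationary distribution of `Q_s`: a probability vector with `π Q = 0`
(the rates are bounded, so this is invariance under the transition semigroup). -/
structure IsStationaryDist (s : ℕ) (lam : ℝ) (p : ℕ → ℝ) (π : ℕ → ℝ) : Prop where
  nonneg : ∀ k, 0 ≤ π k
  total : HasSum π 1
  balance : ∀ j, HasSum (fun i => π i * generator s lam p i j) 0

/-- The average stationary revenue rate under the revenue structure `ρ`. -/
def revenueRate (ρ : ℕ → ℝ) (π : ℕ → ℝ) : ℝ := ∑' k, ρ k * π k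

/-- The arrival rate in the QED regime. -/
def qedRate (γ : ℝ) (s : ℕ) : ℝ := s - γ * √(s : ℝ)

/-- Revenue scaling: `(r_s(k) - n_s) / q_s - r((k - s)/√s) → 0` as `s → ∞`, uniformly in the
state `k`. -/
def RevenueScaling (rs : ℕ → ℕ → ℝ) (n q : ℕ → ℝ) (r : ℝ → ℝ) : Prop :=
  ∀ ε > 0, ∀ᶠ s : ℕ in atTop, ∀ k : ℕ,
    |(rs s k - n s) / q s - r (((k : ℝ) - s) / √(s : ℝ))| ≤ ε

/-- For each number of servers `s`, `p s` is a sequence of admission probabilities. -/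
def IsAdmissionControl (p : ℕ → ℕ → ℝ) : Prop := ∀ s k, p s k ∈ Icc (0 : ℝ) 1

/-- Admission scaling: `p_s(0) ⋯ p_s(m) = f((m + δ)/√s)`. The literature uses the index
conventions `δ = 0` and `δ = 1`. -/
def AdmissionScaling (δ : ℕ) (p : ℕ → ℕ → ℝ) (f : ℝ → ℝ) : Prop :=
  ∀ s : ℕ, 0 < s → ∀ m : ℕ,
    ∏ i ∈ Finset.range (m + 1), p s i = f (((m : ℝ) + δ) / √(s : ℝ))

/-- The threshold control: a customer finding `s + m` customers is admitted iff `m ≤ ⌊η √s⌋`. -/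
def thresholdControl (η : ℝ) (s m : ℕ) : ℝ := if m ≤ ⌊η * √(s : ℝ)⌋₊ then 1 else 0

/-- The threshold profile `1_{[0, η)}`. -/
def thresholdProfile (η : ℝ) : ℝ → ℝ := (Ico 0 η).indicator fun _ => 1

/-- `r` is twice continuously differentiable on `S` (one-sidedly at an end point) and `r`, `r'`,
`r''` are bounded on `S`. -/
def BoundedC2On (r : ℝ → ℝ) (S : Set ℝ) : Prop :=
  ContDiffOn ℝ 2 r S ∧ ∃ C : ℝ, ∀ i ≤ 2, ∀ x ∈ S, |iteratedDerivWithin i r S x| ≤ C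

/-- `g(x) = O(e^{-c x})` as `x → ∞` for some `c > 0`. -/
def ExponentiallySmall (g : ℝ → ℝ) : Prop :=
  ∃ c > 0, g =O[atTop] fun x => Real.exp (-c * x)

/-- `Φ(γ) / φ(γ)` for the standard normal distribution. -/
def millsRatio (γ : ℝ) : ℝ := cdf (gaussianReal 0 1) γ / gaussianPDFReal 0 1 γ

/-- The limiting revenue `R(f)`. -/
def limitRevenue (γ : ℝ) (r f : ℝ → ℝ) : ℝ :=
  ((∫ x in Iio (0 : ℝ), r x * Real.exp (-x ^ 2 / 2 - γ * x)) +
      ∫ x in Ici (0 : ℝ), r x * f x * Real.exp (-γ * x)) /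
    (millsRatio γ + ∫ x in Ici (0 : ℝ), f x * Real.exp (-γ * x))

/-- The limiting revenue `R_T(η)` of a threshold control; `(1 - e^{-γη})/γ` is `η` at `γ = 0`. -/
def thresholdRevenue (γ : ℝ) (r : ℝ → ℝ) (η : ℝ) : ℝ :=
  ((∫ x in Iio (0 : ℝ), r x * Real.exp (-x ^ 2 / 2 - γ * x)) +
      ∫ x in (0 : ℝ)..η, r x * Real.exp (-γ * x)) /
    (millsRatio γ + if γ = 0 then η else (1 - Real.exp (-γ * η)) / γ)

/-- In the QED regime, under the controls `p`, for all large `s` the stationary distribution exists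
and is unique and the revenue series converges absolutely, and `(R_s - n_s) / q_s → L`. -/
def HasRevenueLimit (γ : ℝ) (rs : ℕ → ℕ → ℝ) (n q : ℕ → ℝ) (p : ℕ → ℕ → ℝ) (L : ℝ) : Prop :=
  (∀ᶠ s : ℕ in atTop, ∃! π : ℕ → ℝ, IsStationaryDist s (qedRate γ s) (p s) π) ∧
  ∀ π : ℕ → ℕ → ℝ, (∀ᶠ s : ℕ in atTop, IsStationaryDist s (qedRate γ s) (p s) (π s)) →
    (∀ᶠ s : ℕ in atTop, Summable fun k => rs s k * π s k) ∧
    Tendsto (fun s : ℕ => (revenueRate (rs s) (π s) - n s) / q s) atTop (𝓝 L)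

end

/-! ### Sums as integrals of step functions -/

/-! The balance equations of a birth–death process reduce to detailed balance, so the stationary
distribution is the normalised product weight `stationaryWeight` (`isStationaryDist_iff`). Relative
to state `s`, the weight of `s - j` is `leftWeight` and that of `s + m + 1` is `rightWeight`. At
distance about `x √s` from `s` these converge to `exp (-x ^ 2 / 2 + γ * x)` and `f x * exp (-γ *
x)`.

Sums of weights against a bounded continuous function of `(k - s) / √s`, divided by `√s`, are
Riemann sums. Written as integrals of step functions, they converge by dominated convergence
(`tendsto_riemannSum`), the domination coming from exponential bounds uniform in `s`
(`leftWeight_bound`, `rightWeight_bound`). With test functions `r` and `1`, the common factor, the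
weight of `s` times `√s`, cancels in the quotient. The Gaussian integral over the negative half-line
for `1` is the Mills ratio, so the quotient is `R(f)`. Passing from `r_s` to `r` costs at most the
uniform scaling error, since a stationary distribution has mass one.

The admission products enter only through `HasProfileLimit`: almost everywhere convergence and an
exponential bound. It covers smooth profiles, indicator profiles with either index convention, and
the floor-based threshold controls. -/

theorem integral_floor_eq_tsum {b : ℕ → ℝ} (hb : Summable fun j => |b j|) :
    IntegrableOn (fun x : ℝ => b ⌊x⌋₊) (Ioi 0) ∧ ∫ x in Ioi (0 : ℝ), b ⌊x⌋₊ = ∑' j, b j := by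
  have hU : (⋃ j : ℕ, Ico (j : ℝ) (j + 1)) = Ici 0 := by
    ext x
    simp only [mem_iUnion, mem_Ico, mem_Ici]
    constructor
    · rintro ⟨j, h1, -⟩
      exact (Nat.cast_nonneg j).trans h1
    · intro hx
      exact ⟨⌊x⌋₊, Nat.floor_le hx, Nat.lt_floor_add_one x⟩
  have hfl : ∀ (j : ℕ), ∀ x ∈ Ico (j : ℝ) (j + 1), ⌊x⌋₊ = j := fun j x hx =>
    (Nat.floor_eq_iff ((Nat.cast_nonneg j).trans hx.1)).2 hx
  have hint : ∀ j : ℕ, IntegrableOn (fun x : ℝ => b ⌊x⌋₊) (Ico (j : ℝ) (j + 1)) := by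
    intro j
    have h : IntegrableOn (fun _ : ℝ => b j) (Ico (j : ℝ) (j + 1)) := by
      apply integrableOn_const <;> simp
    exact h.congr_fun (fun x hx => by simp only [hfl j x hx]) measurableSet_Ico
  have hval : ∀ (c : ℕ → ℝ) (j : ℕ), ∫ x in Ico (j : ℝ) (j + 1), c ⌊x⌋₊ = c j := by
    intro c j
    rw [setIntegral_congr_fun measurableSet_Ico
      (fun x hx => by simp only [hfl j x hx] : EqOn _ (fun _ => c j) _)]
    simp
  have hI : IntegrableOn (fun x : ℝ => b ⌊x⌋₊) (⋃ j : ℕ, Ico (j : ℝ) (j + 1)) := by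
    refine integrableOn_iUnion_of_summable_integral_norm hint ?_
    simp only [Real.norm_eq_abs]
    exact hb.congr fun j => (hval (fun j => |b j|) j).symm
  have hdisj : Pairwise (Function.onFun Disjoint fun j : ℕ => Ico (j : ℝ) (j + 1)) := by
    intro i j hij
    refine disjoint_left.2 fun x hi hj => hij ?_
    rw [← hfl i x hi, hfl j x hj]
  have hs := hasSum_integral_iUnion (fun _ => measurableSet_Ico) hdisj hI
  rw [hU] at hI hs
  simp only [hval] at hs
  refine ⟨hI.mono_set Ioi_subset_Ici_self, ?_⟩
  rw [← integral_Ici_eq_integral_Ioi, hs.tsum_eq]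

theorem integral_floor_mul_eq_tsum {b : ℕ → ℝ} (hb : Summable fun j => |b j|) {t : ℝ}
    (ht : 0 < t) :
    IntegrableOn (fun x : ℝ => b ⌊x * t⌋₊) (Ioi 0) ∧
      ∫ x in Ioi (0 : ℝ), b ⌊x * t⌋₊ = t⁻¹ * ∑' j, b j := by
  obtain ⟨h1, h2⟩ := integral_floor_eq_tsum hb
  constructor
  · rw [integrableOn_Ioi_comp_mul_right_iff (fun x : ℝ => b ⌊x⌋₊) 0 ht, zero_mul]
    exact h1
  · rw [integral_comp_mul_right_Ioi (fun x : ℝ => b ⌊x⌋₊) 0 ht, zero_mul, h2, smul_eq_mul]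

theorem tendsto_sqrt_natCast_atTop : Tendsto (fun s : ℕ => √(s : ℝ)) atTop atTop :=
  Real.tendsto_sqrt_atTop.comp tendsto_natCast_atTop_atTop

/-- Rounding to a grid of mesh `1 / t ≤ 1` moves `x` down by at most `1`, which costs a factor `exp
c`. The resulting majorant is independent of `t`, as dominated convergence requires. -/
theorem exp_neg_floor_div_le {c x t : ℝ} (hc : 0 < c) (ht : 1 ≤ t) :
    Real.exp (-c * (⌊x * t⌋₊ / t)) ≤ Real.exp c * Real.exp (-c * x) := by
  rw [← Real.exp_add]
  apply Real.exp_le_exp.2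
  have h1 : x ≤ ⌊x * t⌋₊ / t + 1 := by
    have h2 := (Nat.lt_floor_add_one (x * t)).le
    have h3 : x ≤ (⌊x * t⌋₊ + 1) / t := (le_div_iff₀ (by linarith)).2 h2
    have h4 : 1 / t ≤ 1 := by rw [div_le_one (by linarith)]; exact ht
    rw [add_div] at h3
    linarith
  nlinarith

theorem summable_exp_neg_mul_div {c t : ℝ} (hc : 0 < c) (ht : 0 < t) :
    Summable fun j : ℕ => Real.exp (-c * (j / t)) := by
  have h : (fun j : ℕ => Real.exp (-c * (j / t))) = fun j : ℕ => Real.exp (j * (-c / t)) := by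
    ext j
    congr 1
    ring
  rw [h]
  exact Real.summable_exp_nat_mul_iff.2 (div_neg_of_neg_of_pos (by linarith) ht)

/-- Riemann sums with mesh `1 / √s` under an exponential bound. -/
theorem tendsto_riemannSum {a : ℕ → ℕ → ℝ} {A : ℝ → ℝ} {C c : ℝ} (hc : 0 < c)
    (hbound : ∀ᶠ s in atTop, ∀ j : ℕ, |a s j| ≤ C * Real.exp (-c * (j / √(s : ℝ))))
    (hlim : ∀ᵐ x ∂volume.restrict (Ioi (0 : ℝ)),
      Tendsto (fun s : ℕ => a s ⌊x * √(s : ℝ)⌋₊) atTop (𝓝 (A x))) :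
    IntegrableOn A (Ioi 0) ∧ (∀ᶠ s in atTop, Summable (a s)) ∧
      Tendsto (fun s : ℕ => (√(s : ℝ))⁻¹ * ∑' j, a s j) atTop (𝓝 (∫ x in Ioi 0, A x)) := by
  have h1 : ∀ᶠ s : ℕ in atTop, 1 ≤ √(s : ℝ) := tendsto_sqrt_natCast_atTop.eventually_ge_atTop 1
  have hsum : ∀ᶠ s in atTop, Summable fun j => |a s j| := by
    filter_upwards [hbound, h1] with s hs hs1
    exact Summable.of_nonneg_of_le (fun _ => abs_nonneg _) hs
      ((summable_exp_neg_mul_div hc (by linarith)).mul_left C)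
  have hmeas : ∀ s : ℕ, AEStronglyMeasurable (fun x : ℝ => a s ⌊x * √(s : ℝ)⌋₊)
      (volume.restrict (Ioi 0)) := fun s => by
    have : Measurable fun x : ℝ => a s ⌊x * √(s : ℝ)⌋₊ :=
      (measurable_from_top (f := a s)).comp (Nat.measurable_floor.comp (measurable_id.mul_const _))
    exact this.aestronglyMeasurable
  have hdom : ∀ᶠ s : ℕ in atTop, ∀ x : ℝ,
      ‖a s ⌊x * √(s : ℝ)⌋₊‖ ≤ C * (Real.exp c * Real.exp (-c * x)) := by
    filter_upwards [hbound, h1] with s hs hs1 x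
    have hC : 0 ≤ C := by
      have := (abs_nonneg _).trans (hs 0)
      simpa using this
    exact (hs _).trans (mul_le_mul_of_nonneg_left (exp_neg_floor_div_le hc hs1) hC)
  have hB : IntegrableOn (fun x => C * (Real.exp c * Real.exp (-c * x))) (Ioi 0) :=
    ((exp_neg_integrableOn_Ioi 0 hc).const_mul _).const_mul _
  refine ⟨?_, hsum.mono fun s hs => hs.of_abs, ?_⟩
  -- The limit inherits the common integrable majorant, so integrability of `A` need not be assumed.
  · refine Integrable.mono' hB (aestronglyMeasurable_of_tendsto_ae atTop hmeas hlim) ?_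
    filter_upwards [hlim] with x hx
    exact le_of_tendsto hx.norm (hdom.mono fun s hs => hs x)
  · refine (tendsto_integral_filter_of_dominated_convergence _
      (Eventually.of_forall hmeas) (hdom.mono fun s hs => Eventually.of_forall hs) hB hlim).congr' ?_
    filter_upwards [hsum, h1] with s hs hs1
    exact (integral_floor_mul_eq_tsum hs (by linarith)).2

/-! ### The Mills ratio -/

theorem integrableOn_exp_neg_sq_sub (γ : ℝ) :
    Integrable (fun x : ℝ => Real.exp (-x ^ 2 / 2 - γ * x)) := by
  have h := ((integrable_exp_neg_mul_sq (b := 1 / 2) (by norm_num)).comp_add_right γ).const_mul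
    (Real.exp (γ ^ 2 / 2))
  refine h.congr (Eventually.of_forall fun x => ?_)
  simp only
  rw [← Real.exp_add]
  congr 1
  ring

/-- Translate by `γ` and expand the square: `φ(x + γ) / φ(γ) = exp (-x ^ 2 / 2 - γ * x)`. -/
theorem millsRatio_eq_integral (γ : ℝ) :
    millsRatio γ = ∫ x in Iio (0 : ℝ), Real.exp (-x ^ 2 / 2 - γ * x) := by
  have h1 : cdf (gaussianReal 0 1) γ = ∫ x in Iic γ, gaussianPDFReal 0 1 x := by
    rw [cdf_eq_real, measureReal_def, gaussianReal_apply_eq_integral 0 one_ne_zero,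
      ENNReal.toReal_ofReal (integral_nonneg fun x => gaussianPDFReal_nonneg 0 1 x)]
  have h2 := (measurePreserving_add_right volume γ).setIntegral_preimage_emb
    (measurableEmbedding_addRight γ) (gaussianPDFReal 0 1) (Iic γ)
  have h3 : (fun x : ℝ => x + γ) ⁻¹' Iic γ = Iic 0 := by ext x; simp
  rw [millsRatio, h1, ← h2, h3, integral_Iic_eq_integral_Iio, ← integral_div]
  refine integral_congr_ae (Eventually.of_forall fun x => ?_)
  have hpi : (√(2 * Real.pi)) ≠ 0 := by positivity
  simp only [gaussianPDFReal_def]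
  rw [mul_div_mul_left _ _ (by simpa using hpi), ← Real.exp_sub]
  congr 1
  simp
  ring

theorem millsRatio_pos (γ : ℝ) : 0 < millsRatio γ := by
  rw [millsRatio_eq_integral]
  have : NeZero (volume.restrict (Iio (0 : ℝ))) := ⟨by simp [Measure.restrict_eq_zero]⟩
  exact integral_exp_pos (integrableOn_exp_neg_sq_sub γ).integrableOn

/-! ### Asymptotics of the weights below `s` -/

/-- The ratio of the weights of the states `s - j` and `s`. -/
noncomputable def leftWeight (γ : ℝ) (s j : ℕ) : ℝ :=
  ∏ i ∈ Finset.range j, (1 - (i : ℝ) / s) / (1 - γ / √(s : ℝ))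

theorem leftWeight_eq (γ : ℝ) (s j : ℕ) : leftWeight γ s j =
    (∏ i ∈ Finset.range j, (1 - (i : ℝ) / s)) * ((1 - γ / √(s : ℝ)) ^ j)⁻¹ := by
  rw [leftWeight, Finset.prod_div_distrib, Finset.prod_const, Finset.card_range, div_eq_mul_inv]

/-- The factor `i = s` vanishes, so the finite sum over the states below `s` can be treated as a
series over all `j`. -/
theorem leftWeight_eq_zero {γ : ℝ} {s j : ℕ} (hs : 0 < s) (hj : s < j) : leftWeight γ s j = 0 := by
  refine Finset.prod_eq_zero (i := s) (Finset.mem_range.2 hj) ?_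
  rw [div_self (by exact_mod_cast hs.ne'), sub_self, zero_div]

theorem sum_range_natCast (j : ℕ) : ∑ i ∈ Finset.range j, (i : ℝ) = ((j : ℝ) ^ 2 - j) / 2 := by
  induction j with
  | zero => simp
  | succ j ih => rw [Finset.sum_range_succ, ih]; push_cast; ring

theorem prod_one_sub_div_nonneg {s j : ℕ} (hj : j ≤ s) :
    0 ≤ ∏ i ∈ Finset.range j, (1 - (i : ℝ) / s) := by
  refine Finset.prod_nonneg fun i hi => ?_
  have hi' : (i : ℝ) ≤ s := by exact_mod_cast (Finset.mem_range.1 hi).le.trans hj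
  linarith [div_le_one_of_le₀ hi' (Nat.cast_nonneg s)]

theorem prod_one_sub_div_le {s j : ℕ} (hj : j ≤ s) :
    ∏ i ∈ Finset.range j, (1 - (i : ℝ) / s) ≤ Real.exp (-((j : ℝ) ^ 2 - j) / (2 * s)) := by
  have h : Real.exp (-((j : ℝ) ^ 2 - j) / (2 * s)) =
      ∏ i ∈ Finset.range j, Real.exp (-((i : ℝ) / s)) := by
    rw [← Real.exp_sum, Finset.sum_neg_distrib, ← Finset.sum_div, sum_range_natCast]
    congr 1
    rw [div_div, neg_div]
  rw [h]
  refine Finset.prod_le_prod (fun i hi => ?_) fun i _ => Real.one_sub_le_exp_neg _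
  have hi' : (i : ℝ) ≤ s := by exact_mod_cast (Finset.mem_range.1 hi).le.trans hj
  linarith [div_le_one_of_le₀ hi' (Nat.cast_nonneg s)]

/-- Since `(1 - y) * (1 + y + 2 * y ^ 2) = 1 + y ^ 2 * (1 - 2 * y) ≥ 1`, the claim follows from `1 +
z ≤ exp z` at `z = y + 2 * y ^ 2`. -/
theorem exp_neg_sub_sq_le_one_sub {y : ℝ} (h : y ≤ 1 / 2) :
    Real.exp (-y - 2 * y ^ 2) ≤ 1 - y := by
  have h2 : Real.exp (-y - 2 * y ^ 2) = (Real.exp (y + 2 * y ^ 2))⁻¹ := by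
    rw [← Real.exp_neg]; congr 1; ring
  rw [h2]
  have h3 := Real.add_one_le_exp (y + 2 * y ^ 2)
  refine inv_le_of_inv_le₀ (by linarith) (le_trans ?_ h3)
  rw [inv_le_iff_one_le_mul₀ (by linarith)]
  nlinarith [mul_nonneg (sq_nonneg y) (by linarith [h] : (0 : ℝ) ≤ 1 - 2 * y)]

/-- The condition `2 * j ≤ s` keeps each `i / s` below `1 / 2`. Each quadratic error is bounded by
`2 * (j / s) ^ 2`; the total `2 * j ^ 3 / s ^ 2` is of order `1 / √s` when `j` is of order `√s`. -/
theorem le_prod_one_sub_div {s j : ℕ} (hs : 0 < s) (hj : 2 * j ≤ s) :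
    Real.exp (-((j : ℝ) ^ 2 - j) / (2 * s) - 2 * (j : ℝ) ^ 3 / s ^ 2) ≤
      ∏ i ∈ Finset.range j, (1 - (i : ℝ) / s) := by
  have hs' : (0 : ℝ) < s := by exact_mod_cast hs
  calc Real.exp (-((j : ℝ) ^ 2 - j) / (2 * s) - 2 * (j : ℝ) ^ 3 / s ^ 2)
      ≤ Real.exp (∑ i ∈ Finset.range j, (-((i : ℝ) / s) - 2 * ((j : ℝ) / s) ^ 2)) := by
        rw [Finset.sum_sub_distrib, Finset.sum_neg_distrib, ← Finset.sum_div, sum_range_natCast,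
          Finset.sum_const, Finset.card_range, nsmul_eq_mul]
        apply le_of_eq
        congr 1
        field_simp
    _ = ∏ i ∈ Finset.range j, Real.exp (-((i : ℝ) / s) - 2 * ((j : ℝ) / s) ^ 2) := Real.exp_sum _ _
    _ ≤ ∏ i ∈ Finset.range j, (1 - (i : ℝ) / s) := by
        refine Finset.prod_le_prod (fun _ _ => (Real.exp_pos _).le) fun i hi => ?_
        have hi' : (i : ℝ) ≤ j := by exact_mod_cast (Finset.mem_range.1 hi).le
        have hj' : 2 * (j : ℝ) ≤ s := by exact_mod_cast hj
        have h1 : (i : ℝ) / s ≤ j / s := by gcongr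
        have h0 : 0 ≤ (i : ℝ) / s := by positivity
        have h2 : (i : ℝ) / s ≤ 1 / 2 := by rw [div_le_iff₀ hs']; linarith
        refine le_trans (Real.exp_le_exp.2 ?_) (exp_neg_sub_sq_le_one_sub h2)
        nlinarith

theorem tendsto_floor_mul_sqrt_div {x : ℝ} (hx : 0 ≤ x) :
    Tendsto (fun s : ℕ => (⌊x * √(s : ℝ)⌋₊ : ℝ) / √(s : ℝ)) atTop (𝓝 x) :=
  (tendsto_nat_floor_mul_div_atTop hx).comp tendsto_sqrt_natCast_atTop

theorem tendsto_inv_sqrt_natCast : Tendsto (fun s : ℕ => (√(s : ℝ))⁻¹) atTop (𝓝 0) :=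
  tendsto_sqrt_natCast_atTop.inv_tendsto_atTop

theorem tendsto_one_sub_div_sqrt (γ : ℝ) :
    Tendsto (fun s : ℕ => 1 - γ / √(s : ℝ)) atTop (𝓝 1) := by
  simpa [div_eq_mul_inv] using (tendsto_inv_sqrt_natCast.const_mul γ).const_sub 1

/-- Take logarithms: `√s * log (1 - γ / √s) → -γ`, and the exponent divided by `√s` tends to `x`. -/
theorem tendsto_one_sub_div_sqrt_pow {γ x : ℝ} (hx : 0 ≤ x) :
    Tendsto (fun s : ℕ => (1 - γ / √(s : ℝ)) ^ ⌊x * √(s : ℝ)⌋₊) atTop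
      (𝓝 (Real.exp (-γ * x))) := by
  have h1 := ((Real.tendsto_mul_log_one_add_div_atTop (-γ)).comp tendsto_sqrt_natCast_atTop).mul
    (tendsto_floor_mul_sqrt_div hx)
  refine ((Real.continuous_exp.tendsto _).comp h1).congr' ?_
  filter_upwards [(tendsto_one_sub_div_sqrt γ).eventually (lt_mem_nhds zero_lt_one),
    tendsto_sqrt_natCast_atTop.eventually_gt_atTop 0] with s hs hs0
  simp only [Function.comp_apply]
  have h2 : 1 + -γ / √(s : ℝ) = 1 - γ / √(s : ℝ) := by ring
  rw [h2]
  have h3 : √(s : ℝ) * Real.log (1 - γ / √(s : ℝ)) * (⌊x * √(s : ℝ)⌋₊ / √(s : ℝ)) =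
      ⌊x * √(s : ℝ)⌋₊ * Real.log (1 - γ / √(s : ℝ)) := by
    field_simp
  rw [h3, Real.exp_nat_mul, Real.exp_log hs]

theorem tendsto_prod_one_sub_div {x : ℝ} (hx : 0 ≤ x) :
    Tendsto (fun s : ℕ => ∏ i ∈ Finset.range ⌊x * √(s : ℝ)⌋₊, (1 - (i : ℝ) / s)) atTop
      (𝓝 (Real.exp (-x ^ 2 / 2))) := by
  have hf := tendsto_floor_mul_sqrt_div hx
  have hi := tendsto_inv_sqrt_natCast
  have hsq : ∀ᶠ s : ℕ in atTop, 0 < √(s : ℝ) := tendsto_sqrt_natCast_atTop.eventually_gt_atTop 0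
  have hup : Tendsto (fun s : ℕ => -((⌊x * √(s : ℝ)⌋₊ : ℝ) ^ 2 - ⌊x * √(s : ℝ)⌋₊) / (2 * s)) atTop
      (𝓝 (-x ^ 2 / 2)) := by
    have h := (((hf.pow 2).sub (hf.mul hi)).neg).div_const 2
    rw [mul_zero, sub_zero] at h
    refine h.congr' ?_
    filter_upwards [hsq] with s hs
    have h2 : 2 * (s : ℝ) = 2 * √(s : ℝ) ^ 2 := by rw [Real.sq_sqrt (Nat.cast_nonneg s)]
    rw [h2]
    field_simp
  have hlo : Tendsto (fun s : ℕ => -((⌊x * √(s : ℝ)⌋₊ : ℝ) ^ 2 - ⌊x * √(s : ℝ)⌋₊) / (2 * s)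
      - 2 * (⌊x * √(s : ℝ)⌋₊ : ℝ) ^ 3 / s ^ 2) atTop (𝓝 (-x ^ 2 / 2)) := by
    have h := hup.sub (((hf.pow 3).mul hi).const_mul 2)
    rw [mul_zero, mul_zero, sub_zero] at h
    refine h.congr' ?_
    filter_upwards [hsq] with s hs
    have h2 : (s : ℝ) ^ 2 = √(s : ℝ) ^ 4 := by
      rw [show (4 : ℕ) = 2 * 2 by norm_num, pow_mul, Real.sq_sqrt (Nat.cast_nonneg s)]
    rw [h2]
    congr 1
    field_simp
  have hsmall : ∀ᶠ s : ℕ in atTop, 2 * ⌊x * √(s : ℝ)⌋₊ ≤ s := by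
    have h := (hf.mul hi)
    rw [mul_zero] at h
    filter_upwards [h.eventually (gt_mem_nhds (by norm_num : (0 : ℝ) < 1 / 2)), hsq] with s hs hs0
    have h2 : (s : ℝ) = √(s : ℝ) ^ 2 := (Real.sq_sqrt (Nat.cast_nonneg s)).symm
    rw [div_mul_eq_mul_div, ← div_eq_mul_inv, div_div, div_lt_iff₀ (by positivity), ← sq, ← h2] at hs
    have h3 : (2 * ⌊x * √(s : ℝ)⌋₊ : ℝ) ≤ s := by linarith
    exact_mod_cast h3
  refine tendsto_of_tendsto_of_tendsto_of_le_of_le' ((Real.continuous_exp.tendsto _).comp hlo)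
    ((Real.continuous_exp.tendsto _).comp hup) ?_ ?_
  · filter_upwards [hsmall, eventually_gt_atTop 0] with s hs hs0
    exact le_prod_one_sub_div hs0 hs
  · filter_upwards [hsmall] with s hs
    exact prod_one_sub_div_le (by omega)

theorem tendsto_leftWeight {γ x : ℝ} (hx : 0 ≤ x) :
    Tendsto (fun s : ℕ => leftWeight γ s ⌊x * √(s : ℝ)⌋₊) atTop
      (𝓝 (Real.exp (-x ^ 2 / 2 + γ * x))) := by
  have h := (tendsto_prod_one_sub_div hx).mul
    ((tendsto_one_sub_div_sqrt_pow (γ := γ) hx).inv₀ (Real.exp_ne_zero _))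
  rw [← Real.exp_neg, ← Real.exp_add, neg_mul, neg_neg] at h
  exact h.congr fun s => (leftWeight_eq γ s _).symm

theorem inv_one_sub_le_exp {y : ℝ} (hy : |y| ≤ 1 / 2) : (1 - y)⁻¹ ≤ Real.exp (2 * |y|) := by
  have h1 := le_abs_self y
  have h2 := Real.add_one_le_exp (2 * |y|)
  have h3 := abs_nonneg y
  refine le_trans ?_ h2
  rw [inv_le_iff_one_le_mul₀ (by linarith)]
  nlinarith

theorem leftWeight_bound (γ : ℝ) : ∃ C : ℝ, ∀ᶠ s : ℕ in atTop, ∀ j : ℕ,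
    |leftWeight γ s j| ≤ C * Real.exp (-1 * (j / √(s : ℝ))) := by
  -- With `x = j / √s`, the exponent is at most `-x ^ 2 / 2 + 1 / 2 + 2 * |γ| * x`. Adding `x` for
  -- the decay rate `1` and completing the square at `x = 2 * |γ| + 1` gives the constant. The
  -- condition `√s ≥ 2 * |γ| + 1` ensures `|γ / √s| ≤ 1 / 2`.
  refine ⟨Real.exp (1 / 2 + (2 * |γ| + 1) ^ 2 / 2), ?_⟩
  filter_upwards [eventually_gt_atTop 0,
    tendsto_sqrt_natCast_atTop.eventually_ge_atTop (2 * |γ| + 1)] with s hs hs1 j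
  have hγ := abs_nonneg γ
  have hsq : 0 < √(s : ℝ) := by linarith
  have hs' : (0 : ℝ) < s := by exact_mod_cast hs
  rcases lt_or_ge s j with hj | hj
  · rw [leftWeight_eq_zero hs hj, abs_zero]
    positivity
  have hy : |γ / √(s : ℝ)| ≤ 1 / 2 := by
    rw [abs_div, abs_of_pos hsq, div_le_iff₀ hsq]
    linarith
  have hρ : 0 < 1 - γ / √(s : ℝ) := by linarith [le_abs_self (γ / √(s : ℝ))]
  have h1 := prod_one_sub_div_le hj
  have h0 := prod_one_sub_div_nonneg hj
  rw [leftWeight_eq, abs_of_nonneg (mul_nonneg h0 (by positivity)), ← inv_pow]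
  have h2 : (1 - γ / √(s : ℝ))⁻¹ ^ j ≤ Real.exp (j * (2 * |γ / √(s : ℝ)|)) := by
    rw [Real.exp_nat_mul]
    exact pow_le_pow_left₀ (by positivity) (inv_one_sub_le_exp hy) j
  refine (mul_le_mul h1 h2 (by positivity) (Real.exp_pos _).le).trans ?_
  rw [← Real.exp_add, ← Real.exp_add]
  apply Real.exp_le_exp.2
  rw [abs_div, abs_of_pos hsq]
  set x : ℝ := j / √(s : ℝ) with hx
  have e1 : -((j : ℝ) ^ 2 - j) / (2 * s) = -x ^ 2 / 2 + j / s / 2 := by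
    rw [hx, div_pow, Real.sq_sqrt hs'.le]
    field_simp
    ring
  have e2 : (j : ℝ) * (2 * (|γ| / √(s : ℝ))) = 2 * |γ| * x := by rw [hx]; ring
  have e3 : (j : ℝ) / s ≤ 1 := div_le_one_of_le₀ (by exact_mod_cast hj) hs'.le
  rw [e1, e2]
  nlinarith [sq_nonneg (x - (2 * |γ| + 1))]

/-! ### Stationary distributions -/

/-- The reversible measure of the birth–death process, normalised by `stationaryWeight 0 = 1`. -/
noncomputable def stationaryWeight (s : ℕ) (lam : ℝ) (p : ℕ → ℝ) (k : ℕ) : ℝ :=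
  ∏ i ∈ Finset.range k, arrivalRate s lam p i / serviceRate s (i + 1)

theorem stationaryWeight_succ (s : ℕ) (lam : ℝ) (p : ℕ → ℝ) (k : ℕ) :
    stationaryWeight s lam p (k + 1) =
      stationaryWeight s lam p k * (arrivalRate s lam p k / serviceRate s (k + 1)) :=
  Finset.prod_range_succ _ _

theorem serviceRate_succ_pos {s : ℕ} (hs : 0 < s) (k : ℕ) : 0 < serviceRate s (k + 1) := by
  unfold serviceRate
  exact_mod_cast lt_min (Nat.succ_pos k) hs

theorem arrivalRate_nonneg {s : ℕ} {lam : ℝ} (hlam : 0 ≤ lam) {p : ℕ → ℝ} (hp : ∀ k, 0 ≤ p k)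
    (k : ℕ) : 0 ≤ arrivalRate s lam p k := by
  unfold arrivalRate
  split_ifs
  exacts [hlam, mul_nonneg hlam (hp _)]

theorem stationaryWeight_nonneg {s : ℕ} (hs : 0 < s) {lam : ℝ} (hlam : 0 ≤ lam) {p : ℕ → ℝ}
    (hp : ∀ k, 0 ≤ p k) (k : ℕ) : 0 ≤ stationaryWeight s lam p k :=
  Finset.prod_nonneg fun i _ =>
    div_nonneg (arrivalRate_nonneg hlam hp i) (serviceRate_succ_pos hs i).le

theorem hasSum_generator_zero (s : ℕ) (lam : ℝ) (p π : ℕ → ℝ) :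
    HasSum (fun i => π i * generator s lam p i 0)
      (π 1 * serviceRate s 1 - π 0 * arrivalRate s lam p 0) := by
  have h := hasSum_sum_of_ne_finset_zero (L := .unconditional ℕ)
    (f := fun i => π i * generator s lam p i 0)
    (s := {0, 1}) (fun i hi => by
      simp only [Finset.mem_insert, Finset.mem_singleton, not_or] at hi
      have h2 : generator s lam p i 0 = 0 := by
        unfold generator
        rw [if_neg (by omega), if_neg (by omega), if_neg (by omega)]
      rw [h2, mul_zero])
  convert h using 1
  rw [Finset.sum_pair (by norm_num)]
  simp [generator, serviceRate]
  ring

theorem hasSum_generator_succ (s : ℕ) (lam : ℝ) (p π : ℕ → ℝ) (j : ℕ) :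
    HasSum (fun i => π i * generator s lam p i (j + 1))
      ((π (j + 2) * serviceRate s (j + 2) - π (j + 1) * arrivalRate s lam p (j + 1)) -
        (π (j + 1) * serviceRate s (j + 1) - π j * arrivalRate s lam p j)) := by
  have h := hasSum_sum_of_ne_finset_zero (L := .unconditional ℕ)
    (f := fun i => π i * generator s lam p i (j + 1))
    (s := {j, j + 1, j + 2}) (fun i hi => by
      simp only [Finset.mem_insert, Finset.mem_singleton, not_or] at hi
      have h2 : generator s lam p i (j + 1) = 0 := by
        unfold generator
        rw [if_neg (by omega), if_neg (by omega), if_neg (by omega)]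
      rw [h2, mul_zero])
  convert h using 1
  rw [Finset.sum_insert (by simp), Finset.sum_pair (by simp)]
  simp [generator]
  ring

/-- The balance equation at `j + 1` says that the net flux across the edge above `j + 1` equals that
across the edge below it. At `0` the flux vanishes, so it vanishes everywhere by induction. -/
theorem balance_iff (s : ℕ) (lam : ℝ) (p π : ℕ → ℝ) :
    (∀ j, HasSum (fun i => π i * generator s lam p i j) 0) ↔
      ∀ k, π (k + 1) * serviceRate s (k + 1) = π k * arrivalRate s lam p k := by
  constructor
  · intro h k
    induction k with
    | zero => linarith [(h 0).unique (hasSum_generator_zero s lam p π)]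
    | succ k ih => linarith [(h (k + 1)).unique (hasSum_generator_succ s lam p π k)]
  · intro h j
    cases j with
    | zero =>
      convert hasSum_generator_zero s lam p π using 1
      linarith [h 0]
    | succ j =>
      convert hasSum_generator_succ s lam p π j using 1
      linarith [h j, h (j + 1)]

theorem IsStationaryDist.eq_weight {s : ℕ} (hs : 0 < s) {lam : ℝ} {p π : ℕ → ℝ}
    (h : IsStationaryDist s lam p π) (k : ℕ) : π k = π 0 * stationaryWeight s lam p k := by
  induction k with
  | zero => simp [stationaryWeight]
  | succ k ih =>
    have hb := (balance_iff s lam p π).1 h.balance k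
    rw [stationaryWeight_succ, ← mul_assoc, ← ih, ← mul_div_assoc,
      eq_div_iff (serviceRate_succ_pos hs k).ne', hb]

/-- Detailed balance determines `π` up to the factor `π 0`, because service rates are positive even
where arrival rates vanish; total mass one fixes this factor. -/
theorem isStationaryDist_iff {s : ℕ} (hs : 0 < s) {lam : ℝ} (hlam : 0 ≤ lam) {p : ℕ → ℝ}
    (hp : ∀ k, 0 ≤ p k) (hw : Summable (stationaryWeight s lam p)) {π : ℕ → ℝ} :
    IsStationaryDist s lam p π ↔
      π = fun k => stationaryWeight s lam p k / ∑' i, stationaryWeight s lam p i := by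
  have hw0 := stationaryWeight_nonneg hs hlam hp
  have hZ : 0 < ∑' i, stationaryWeight s lam p i :=
    hw.tsum_pos hw0 0 (by simp [stationaryWeight])
  constructor
  · intro h
    have h1 : HasSum π (π 0 * ∑' i, stationaryWeight s lam p i) := by
      rw [funext (h.eq_weight hs)]
      simpa [stationaryWeight] using hw.hasSum.mul_left (π 0)
    have h2 := h1.unique h.total
    ext k
    rw [h.eq_weight hs k, eq_div_iff hZ.ne', mul_right_comm, h2, one_mul]
  · rintro rfl
    refine ⟨fun k => div_nonneg (hw0 k) hZ.le, ?_, (balance_iff _ _ _ _).2 fun k => ?_⟩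
    · simpa [div_self hZ.ne'] using hw.hasSum.div_const (∑' i, stationaryWeight s lam p i)
    · have := (serviceRate_succ_pos hs k).ne'
      rw [stationaryWeight_succ]
      field_simp

/-! ### Weights in the QED regime -/

/-- The ratio of the weights of the states `s + m + 1` and `s`. -/
noncomputable def rightWeight (γ : ℝ) (p : ℕ → ℕ → ℝ) (s m : ℕ) : ℝ :=
  (1 - γ / √(s : ℝ)) ^ (m + 1) * ∏ i ∈ Finset.range (m + 1), p s i

theorem qedRate_eq {s : ℕ} (hs : 0 < s) (γ : ℝ) : qedRate γ s = s * (1 - γ / √(s : ℝ)) := by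
  have hs' : (0 : ℝ) < s := by exact_mod_cast hs
  have h : (s : ℝ) / √(s : ℝ) = √(s : ℝ) := Real.div_sqrt
  rw [qedRate, mul_sub, mul_one, mul_div_left_comm, h]

/-- Descending from state `s`, each step inverts a ratio of arrival to service rate. The product
form avoids dividing by the weight of `s`. -/
theorem stationaryWeight_sub {s : ℕ} (hs : 0 < s) {γ : ℝ} (hρ : 0 < 1 - γ / √(s : ℝ)) (p : ℕ → ℝ)
    {j : ℕ} (hj : j ≤ s) : stationaryWeight s (qedRate γ s) p (s - j) =
      stationaryWeight s (qedRate γ s) p s * leftWeight γ s j := by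
  induction j with
  | zero => simp [leftWeight]
  | succ j ih =>
    have hs' : (0 : ℝ) < s := by exact_mod_cast hs
    obtain ⟨k, hk⟩ : ∃ k, s = k + (j + 1) := ⟨s - (j + 1), by omega⟩
    have h1 : s - (j + 1) = k := by omega
    have h2 : s - j = k + 1 := by omega
    have h3 := ih (by omega)
    have h4 : serviceRate s (k + 1) = s * (1 - (j : ℝ) / s) := by
      rw [serviceRate, min_eq_left (by omega), mul_sub, mul_one, mul_div_cancel₀ _ hs'.ne']
      rw [hk]; push_cast; ring
    have h5 := serviceRate_succ_pos hs k
    rw [h2, stationaryWeight_succ, arrivalRate, if_pos (by omega), qedRate_eq hs, h4,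
      mul_div_mul_left _ _ hs'.ne', ← qedRate_eq hs] at h3
    rw [h4] at h5
    have h6 : 0 < 1 - (j : ℝ) / s := pos_of_mul_pos_right h5 hs'.le
    rw [h1, leftWeight, Finset.prod_range_succ, ← leftWeight, ← mul_assoc, ← h3, mul_assoc,
      div_mul_div_cancel₀ h6.ne', div_self hρ.ne', mul_one]

theorem stationaryWeight_add {s : ℕ} (hs : 0 < s) (γ : ℝ) (p : ℕ → ℕ → ℝ) (m : ℕ) :
    stationaryWeight s (qedRate γ s) (p s) (m + (s + 1)) =
      stationaryWeight s (qedRate γ s) (p s) s * rightWeight γ p s m := by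
  have hs' : (0 : ℝ) < s := by exact_mod_cast hs
  have h : ∀ m, arrivalRate s (qedRate γ s) (p s) (s + m) / serviceRate s (s + m + 1) =
      (1 - γ / √(s : ℝ)) * p s m := by
    intro m
    rw [arrivalRate, if_neg (by omega), serviceRate, min_eq_right (by omega), qedRate_eq hs,
      Nat.add_sub_cancel_left]
    field_simp
  induction m with
  | zero =>
    rw [zero_add, stationaryWeight_succ]
    have := h 0
    rw [add_zero] at this
    rw [this]
    simp [rightWeight]
  | succ m ih =>
    rw [show m + 1 + (s + 1) = s + (m + 1) + 1 by ring, stationaryWeight_succ, h,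
      show s + (m + 1) = m + (s + 1) by ring, ih, rightWeight, rightWeight,
      Finset.prod_range_succ _ (m + 1)]
    ring

/-- The state space is split just above `s`: state `s` is the term `j = 0` of the reversed left sum,
and the right sum starts at `s + 1`, whence the argument `(m + 1) / √s`. -/
theorem hasSum_stationaryWeight_mul {s : ℕ} (hs : 0 < s) {γ : ℝ} (hρ : 0 < 1 - γ / √(s : ℝ))
    (p : ℕ → ℕ → ℝ) (g : ℝ → ℝ) {R : ℝ}
    (hR : HasSum (fun m => rightWeight γ p s m * g (((m : ℝ) + 1) / √(s : ℝ))) R) :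
    HasSum (fun k => stationaryWeight s (qedRate γ s) (p s) k * g (((k : ℝ) - s) / √(s : ℝ)))
      (stationaryWeight s (qedRate γ s) (p s) s *
        ((∑' j, leftWeight γ s j * g (-((j : ℝ) / √(s : ℝ)))) + R)) := by
  have hL : ∑' j, leftWeight γ s j * g (-((j : ℝ) / √(s : ℝ))) =
      ∑ j ∈ Finset.range (s + 1), leftWeight γ s j * g (-((j : ℝ) / √(s : ℝ))) := by
    refine tsum_eq_sum fun j hj => ?_
    rw [leftWeight_eq_zero hs (by simpa using hj), zero_mul]
  rw [hL, mul_add, add_comm, Finset.mul_sum]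
  have h1 : ∑ j ∈ Finset.range (s + 1), stationaryWeight s (qedRate γ s) (p s) s *
      (leftWeight γ s j * g (-((j : ℝ) / √(s : ℝ)))) = ∑ k ∈ Finset.range (s + 1),
        stationaryWeight s (qedRate γ s) (p s) k * g (((k : ℝ) - s) / √(s : ℝ)) := by
    rw [← Finset.sum_flip fun k =>
      stationaryWeight s (qedRate γ s) (p s) k * g (((k : ℝ) - s) / √(s : ℝ))]
    refine Finset.sum_congr rfl fun j hj => ?_
    have hj' : j ≤ s := by simpa [Nat.lt_succ_iff] using hj
    rw [stationaryWeight_sub hs hρ _ hj', Nat.cast_sub hj', mul_assoc]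
    congr 3
    ring
  rw [h1]
  refine (hasSum_nat_add_iff (s + 1)).1 ?_
  refine (hR.mul_left (stationaryWeight s (qedRate γ s) (p s) s)).congr_fun ?_
  intro m
  rw [stationaryWeight_add hs, mul_assoc]
  congr 3
  push_cast
  ring

/-! ### The limit of the normalised sums -/

/-- `p_s(0) ⋯ p_s(⌊x √s⌋) → f(x)` for almost every `x > 0`, with an exponential bound on the
products tilted by `e^{-γ x}`. -/
structure HasProfileLimit (γ : ℝ) (p : ℕ → ℕ → ℝ) (f : ℝ → ℝ) : Prop where
  bound : ∃ C c : ℝ, 0 < c ∧ ∀ᶠ s : ℕ in atTop, ∀ m : ℕ,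
    Real.exp (-γ * (m / √(s : ℝ))) * ∏ i ∈ Finset.range (m + 1), p s i ≤
      C * Real.exp (-c * (m / √(s : ℝ)))
  lim : ∀ᵐ x ∂volume.restrict (Ioi (0 : ℝ)), Tendsto
    (fun s : ℕ => ∏ i ∈ Finset.range (⌊x * √(s : ℝ)⌋₊ + 1), p s i) atTop (𝓝 (f x))

theorem eventually_one_sub_div_sqrt_pos (γ : ℝ) : ∀ᶠ s : ℕ in atTop, 0 < 1 - γ / √(s : ℝ) :=
  (tendsto_one_sub_div_sqrt γ).eventually (lt_mem_nhds zero_lt_one)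

theorem rightWeight_bound {γ : ℝ} {p : ℕ → ℕ → ℝ} {f : ℝ → ℝ} (hp : IsAdmissionControl p)
    (h : HasProfileLimit γ p f) : ∃ C c : ℝ, 0 < c ∧ ∀ᶠ s : ℕ in atTop, ∀ m : ℕ,
      |rightWeight γ p s m| ≤ C * Real.exp (-c * (m / √(s : ℝ))) := by
  obtain ⟨C, c, hc, hb⟩ := h.bound
  refine ⟨Real.exp |γ| * C, c, hc, ?_⟩
  filter_upwards [hb, eventually_one_sub_div_sqrt_pos γ,
    tendsto_sqrt_natCast_atTop.eventually_ge_atTop 1] with s hs hρ h1 m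
  have hP : 0 ≤ ∏ i ∈ Finset.range (m + 1), p s i := Finset.prod_nonneg fun i _ => (hp s i).1
  rw [rightWeight, abs_of_nonneg (mul_nonneg (pow_nonneg hρ.le _) hP)]
  -- Here `1 - y ≤ exp (-y)`; the one extra power beyond `m` is absorbed by `exp |γ|`, since `√s ≥
  -- 1`.
  have h2 : (1 - γ / √(s : ℝ)) ^ (m + 1) ≤ Real.exp |γ| * Real.exp (-γ * (m / √(s : ℝ))) := by
    refine (pow_le_pow_left₀ hρ.le (Real.one_sub_le_exp_neg _) (m + 1)).trans ?_
    rw [← Real.exp_nat_mul, ← Real.exp_add]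
    apply Real.exp_le_exp.2
    have h3 : -(γ / √(s : ℝ)) ≤ |γ| := by
      refine (neg_le_abs _).trans ?_
      rw [abs_div, abs_of_pos (by linarith : (0 : ℝ) < √(s : ℝ))]
      exact div_le_self (abs_nonneg γ) h1
    have h4 : -γ * (m / √(s : ℝ)) = m * -(γ / √(s : ℝ)) := by ring
    rw [h4]
    push_cast
    linarith
  calc _ ≤ Real.exp |γ| * Real.exp (-γ * (m / √(s : ℝ))) * ∏ i ∈ Finset.range (m + 1), p s i :=
        mul_le_mul_of_nonneg_right h2 hP
    _ ≤ _ := by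
        rw [mul_assoc, mul_assoc]
        exact mul_le_mul_of_nonneg_left (hs m) (Real.exp_pos _).le

theorem mul_bound {a : ℕ → ℕ → ℝ} {b : ℕ → ℕ → ℝ} {C c K : ℝ}
    (ha : ∀ᶠ s : ℕ in atTop, ∀ j : ℕ, |a s j| ≤ C * Real.exp (-c * (j / √(s : ℝ))))
    (hb : ∀ s j, |b s j| ≤ K) :
    ∀ᶠ s : ℕ in atTop, ∀ j : ℕ, |a s j * b s j| ≤ C * K * Real.exp (-c * (j / √(s : ℝ))) := by
  filter_upwards [ha] with s hs j
  rw [abs_mul, mul_right_comm]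
  exact mul_le_mul (hs j) (hb s j) (abs_nonneg _) ((abs_nonneg _).trans (hs j))

theorem tendsto_left_sum (γ : ℝ) {g : ℝ → ℝ} (hg : Continuous g) {K : ℝ} (hK : ∀ x, |g x| ≤ K) :
    IntegrableOn (fun x => g x * Real.exp (-x ^ 2 / 2 - γ * x)) (Iio 0) ∧
      Tendsto (fun s : ℕ => (√(s : ℝ))⁻¹ * ∑' j, leftWeight γ s j * g (-((j : ℝ) / √(s : ℝ)))) atTop
        (𝓝 (∫ x in Iio (0 : ℝ), g x * Real.exp (-x ^ 2 / 2 - γ * x))) := by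
  obtain ⟨C, hC⟩ := leftWeight_bound γ
  have hlim : ∀ᵐ x ∂volume.restrict (Ioi (0 : ℝ)), Tendsto (fun s : ℕ =>
      leftWeight γ s ⌊x * √(s : ℝ)⌋₊ * g (-((⌊x * √(s : ℝ)⌋₊ : ℝ) / √(s : ℝ)))) atTop
        (𝓝 (Real.exp (-x ^ 2 / 2 + γ * x) * g (-x))) := by
    filter_upwards [ae_restrict_mem measurableSet_Ioi] with x hx
    exact (tendsto_leftWeight (le_of_lt hx)).mul
      ((hg.tendsto _).comp (tendsto_floor_mul_sqrt_div (le_of_lt hx)).neg)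
  obtain ⟨-, -, h3⟩ := tendsto_riemannSum one_pos
    (mul_bound (b := fun s j => g (-((j : ℝ) / √(s : ℝ)))) hC fun s j => hK _) hlim
  constructor
  · refine ((integrableOn_exp_neg_sq_sub γ).bdd_mul (c := K) hg.aestronglyMeasurable
      (Eventually.of_forall hK)).integrableOn
  · rw [← integral_Iic_eq_integral_Iio]
    -- The Riemann sum runs over the distance below `s`; reflection carries its limit to the
    -- negative half-line.
    have h4 := integral_comp_neg_Iic (0 : ℝ) fun x => Real.exp (-x ^ 2 / 2 + γ * x) * g (-x)
    rw [neg_zero] at h4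
    rw [← h4] at h3
    have h5 : (fun x : ℝ => Real.exp (-(-x) ^ 2 / 2 + γ * -x) * g (- -x)) =
        fun x => g x * Real.exp (-x ^ 2 / 2 - γ * x) := by
      ext x
      rw [neg_neg, mul_comm, neg_sq, mul_neg, ← sub_eq_add_neg]
    rwa [h5] at h3

theorem tendsto_right_sum {γ : ℝ} {p : ℕ → ℕ → ℝ} {f : ℝ → ℝ} (hp : IsAdmissionControl p)
    (h : HasProfileLimit γ p f) {g : ℝ → ℝ} (hg : Continuous g) {K : ℝ} (hK : ∀ x, |g x| ≤ K) :
    IntegrableOn (fun x => g x * f x * Real.exp (-γ * x)) (Ici 0) ∧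
      (∀ᶠ s : ℕ in atTop,
        Summable fun m : ℕ => rightWeight γ p s m * g (((m : ℝ) + 1) / √(s : ℝ))) ∧
      Tendsto (fun s : ℕ => (√(s : ℝ))⁻¹ *
          ∑' m : ℕ, rightWeight γ p s m * g (((m : ℝ) + 1) / √(s : ℝ))) atTop
        (𝓝 (∫ x in Ici (0 : ℝ), g x * f x * Real.exp (-γ * x))) := by
  obtain ⟨C, c, hc, hC⟩ := rightWeight_bound hp h
  rw [integrableOn_Ici_iff_integrableOn_Ioi, integral_Ici_eq_integral_Ioi]
  refine tendsto_riemannSum hc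
    (mul_bound (b := fun s j => g (((j : ℝ) + 1) / √(s : ℝ))) hC fun s j => hK _) ?_
  filter_upwards [ae_restrict_mem measurableSet_Ioi, h.lim] with x hx hf
  have h1 : Tendsto (fun s : ℕ => (1 - γ / √(s : ℝ)) ^ (⌊x * √(s : ℝ)⌋₊ + 1)) atTop
      (𝓝 (Real.exp (-γ * x))) := by
    simpa [pow_succ] using
      (tendsto_one_sub_div_sqrt_pow (γ := γ) (le_of_lt hx)).mul (tendsto_one_sub_div_sqrt γ)
  have h2 : Tendsto (fun s : ℕ => ((⌊x * √(s : ℝ)⌋₊ : ℝ) + 1) / √(s : ℝ)) atTop (𝓝 x) := by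
    simpa [add_div] using (tendsto_floor_mul_sqrt_div (le_of_lt hx)).add tendsto_inv_sqrt_natCast
  have h3 := (h1.mul hf).mul ((hg.tendsto _).comp h2)
  rwa [show Real.exp (-γ * x) * f x * g x = g x * f x * Real.exp (-γ * x) by ring] at h3

/-- The prefactor in front of `V s` does not depend on `g`, so it cancels when the sums for `g = r`
and `g = 1` are divided. -/
theorem tendsto_weight_sum {γ : ℝ} {p : ℕ → ℕ → ℝ} {f : ℝ → ℝ} (hp : IsAdmissionControl p)
    (h : HasProfileLimit γ p f) {g : ℝ → ℝ} (hg : Continuous g) {K : ℝ} (hK : ∀ x, |g x| ≤ K) :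
    (∀ᶠ s : ℕ in atTop, Summable fun k : ℕ =>
      stationaryWeight s (qedRate γ s) (p s) k * g (((k : ℝ) - s) / √(s : ℝ))) ∧
    ∃ V : ℕ → ℝ, Tendsto V atTop (𝓝 ((∫ x in Iio (0 : ℝ), g x * Real.exp (-x ^ 2 / 2 - γ * x)) +
        ∫ x in Ici (0 : ℝ), g x * f x * Real.exp (-γ * x))) ∧
      ∀ᶠ s : ℕ in atTop,
        ∑' k : ℕ, stationaryWeight s (qedRate γ s) (p s) k * g (((k : ℝ) - s) / √(s : ℝ)) =
          stationaryWeight s (qedRate γ s) (p s) s * √(s : ℝ) * V s := by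
  obtain ⟨-, hL⟩ := tendsto_left_sum γ hg hK
  obtain ⟨-, hs, hR⟩ := tendsto_right_sum hp h hg hK
  have key : ∀ᶠ s : ℕ in atTop, HasSum (fun k : ℕ =>
      stationaryWeight s (qedRate γ s) (p s) k * g (((k : ℝ) - s) / √(s : ℝ)))
      (stationaryWeight s (qedRate γ s) (p s) s *
        ((∑' j, leftWeight γ s j * g (-((j : ℝ) / √(s : ℝ)))) +
          ∑' m : ℕ, rightWeight γ p s m * g (((m : ℝ) + 1) / √(s : ℝ)))) := by
    filter_upwards [hs, eventually_gt_atTop 0, eventually_one_sub_div_sqrt_pos γ] with s h1 h2 h3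
    exact hasSum_stationaryWeight_mul h2 h3 p g h1.hasSum
  refine ⟨key.mono fun s h1 => h1.summable, _, hL.add hR, ?_⟩
  filter_upwards [key, eventually_gt_atTop 0] with s h1 h2
  have h3 : 0 < √(s : ℝ) := Real.sqrt_pos.2 (by exact_mod_cast h2)
  rw [h1.tsum_eq, ← mul_add, mul_assoc, mul_inv_cancel_left₀ h3.ne']

/-! ### Revenue -/

/-- Write `ρ = n + q * (error + h)` and average: as `π` has mass one, the constant `n` is recovered
exactly and the error averages to at most `ε`. -/
theorem revenueRate_approx {ρ h π : ℕ → ℝ} {n q ε : ℝ} (hq : q ≠ 0) (hπ : ∀ k, 0 ≤ π k)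
    (hπ1 : HasSum π 1) (hh : Summable fun k => h k * π k)
    (hε : ∀ k, |(ρ k - n) / q - h k| ≤ ε) :
    (Summable fun k => ρ k * π k) ∧ |(revenueRate ρ π - n) / q - ∑' k, h k * π k| ≤ ε := by
  have hb : ∀ k, ‖((ρ k - n) / q - h k) * π k‖ ≤ ε * π k := fun k => by
    rw [Real.norm_eq_abs, abs_mul, abs_of_nonneg (hπ k)]
    exact mul_le_mul_of_nonneg_right (hε k) (hπ k)
  have hs : HasSum (fun k => ε * π k) ε := by simpa using hπ1.mul_left ε
  have he : Summable fun k => ((ρ k - n) / q - h k) * π k :=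
    Summable.of_norm_bounded hs.summable hb
  have h1 := (hπ1.mul_left n).add ((he.hasSum.add hh.hasSum).mul_left q)
  have h2 : (fun k => n * π k + q * (((ρ k - n) / q - h k) * π k + h k * π k)) =
      fun k => ρ k * π k := by
    ext k
    field_simp
    ring
  rw [h2] at h1
  refine ⟨h1.summable, ?_⟩
  rw [revenueRate, h1.tsum_eq]
  have h3 : (n * 1 + q * (∑' k, ((ρ k - n) / q - h k) * π k + ∑' k, h k * π k) - n) / q -
      ∑' k, h k * π k = ∑' k, ((ρ k - n) / q - h k) * π k := by
    field_simp
    ring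
  rw [h3]
  exact tsum_of_norm_bounded hs hb

theorem hasRevenueLimit_of_profileLimit {γ : ℝ} {r : ℝ → ℝ} {rs : ℕ → ℕ → ℝ} {n q : ℕ → ℝ}
    (hq : ∀ s, 0 < s → q s ≠ 0) (hr : Continuous r) {K : ℝ} (hK : ∀ x, |r x| ≤ K)
    (hrs : RevenueScaling rs n q r) {p : ℕ → ℕ → ℝ} (hp : IsAdmissionControl p) {f : ℝ → ℝ}
    (h : HasProfileLimit γ p f) :
    HasRevenueLimit γ rs n q p (limitRevenue γ r f) := by
  obtain ⟨hsum1, V1, hV1, hV1'⟩ := tendsto_weight_sum hp h (g := fun _ => 1) continuous_const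
    (K := 1) (by simp)
  obtain ⟨hsumr, Vr, hVr, hVr'⟩ := tendsto_weight_sum hp h hr hK
  simp only [mul_one, one_mul] at hsum1 hV1 hV1'
  rw [← millsRatio_eq_integral] at hV1
  -- Almost everywhere on the half-line `f` is a limit of products of probabilities, hence
  -- nonnegative; the denominator is then at least the positive Mills ratio.
  have hf : 0 ≤ ∫ x in Ici (0 : ℝ), f x * Real.exp (-γ * x) := by
    rw [integral_Ici_eq_integral_Ioi]
    refine integral_nonneg_of_ae ?_
    filter_upwards [h.lim] with x hx
    exact mul_nonneg (ge_of_tendsto' hx fun s => Finset.prod_nonneg fun i _ => (hp s i).1)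
      (Real.exp_pos _).le
  have hD : millsRatio γ + ∫ x in Ici (0 : ℝ), f x * Real.exp (-γ * x) ≠ 0 := by
    linarith [millsRatio_pos γ]
  have hiff : ∀ᶠ s : ℕ in atTop, ∀ π : ℕ → ℝ, IsStationaryDist s (qedRate γ s) (p s) π ↔
      π = fun k => stationaryWeight s (qedRate γ s) (p s) k /
        ∑' i, stationaryWeight s (qedRate γ s) (p s) i := by
    filter_upwards [hsum1, eventually_gt_atTop 0, eventually_one_sub_div_sqrt_pos γ]
      with s h1 h2 h3 π
    refine isStationaryDist_iff h2 ?_ (fun k => (hp s k).1) h1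
    rw [qedRate_eq h2]
    positivity
  refine ⟨?_, fun π hπ => ?_⟩
  · filter_upwards [hiff] with s hs
    exact ⟨_, (hs _).2 rfl, fun π hπ => (hs π).1 hπ⟩
  have hterm : ∀ᶠ s : ℕ in atTop, (fun k : ℕ => r (((k : ℝ) - s) / √(s : ℝ)) * π s k) =
      fun k : ℕ => stationaryWeight s (qedRate γ s) (p s) k * r (((k : ℝ) - s) / √(s : ℝ)) /
        ∑' i, stationaryWeight s (qedRate γ s) (p s) i := by
    filter_upwards [hiff, hπ] with s h1 h2
    rw [(h1 _).1 h2]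
    ext k
    ring
  have hrsum : ∀ᶠ s : ℕ in atTop, Summable fun k : ℕ => r (((k : ℝ) - s) / √(s : ℝ)) * π s k := by
    filter_upwards [hterm, hsumr] with s h1 h2
    rw [h1]
    exact h2.div_const _
  have happrox : ∀ ε > 0, ∀ᶠ s : ℕ in atTop, (Summable fun k => rs s k * π s k) ∧
      |(revenueRate (rs s) (π s) - n s) / q s -
        ∑' k : ℕ, r (((k : ℝ) - s) / √(s : ℝ)) * π s k| ≤ ε := fun ε hε => by
    filter_upwards [hrs ε hε, hπ, hrsum, eventually_gt_atTop 0] with s h1 h2 h3 h4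
    exact revenueRate_approx (hq s h4) h2.nonneg h2.total h3 h1
  refine ⟨(happrox 1 one_pos).mono fun s hs => hs.1, ?_⟩
  have hmain : Tendsto (fun s : ℕ => ∑' k : ℕ, r (((k : ℝ) - s) / √(s : ℝ)) * π s k) atTop
      (𝓝 (limitRevenue γ r f)) := by
    refine (hVr.div hV1 hD).congr' ?_
    filter_upwards [hterm, hVr', hV1', hπ, hiff, eventually_gt_atTop 0] with s h1 h2 h3 h4 h5 h6
    rw [h1, tsum_div_const, h2, h3]
    -- A zero factor would make the normalising sum zero; with division by zero equal to zero, `π s`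
    -- would then vanish identically, contradicting total mass one.
    have hne : stationaryWeight s (qedRate γ s) (p s) s * √(s : ℝ) ≠ 0 := by
      intro h0
      rw [h0, zero_mul] at h3
      have h7 := h4.total
      rw [(h5 _).1 h4, h3] at h7
      simp only [div_zero] at h7
      exact zero_ne_one (hasSum_zero.unique h7)
    exact (mul_div_mul_left _ _ hne).symm
  refine hmain.congr_dist (Metric.tendsto_nhds.2 fun ε hε => ?_)
  filter_upwards [happrox (ε / 2) (by linarith)] with s hs
  rw [Real.dist_0_eq_abs, abs_of_nonneg dist_nonneg, dist_comm, Real.dist_eq]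
  linarith [hs.2]

/-! ### Admission profiles -/

/-- The shift by `δ / √s ≤ 1` costs at most `exp |γ|` in the bound and disappears in the limit, so
both index conventions give the same profile. -/
theorem AdmissionScaling.hasProfileLimit {γ : ℝ} {δ : ℕ} (hδ : δ ≤ 1) {p : ℕ → ℕ → ℝ} {f : ℝ → ℝ}
    (hpf : AdmissionScaling δ p f)
    (hf : ∀ᵐ x ∂volume.restrict (Ioi (0 : ℝ)), ContinuousAt f x) {C c : ℝ} (hc : 0 < c)
    (hb : ∀ x, 0 ≤ x → |f x * Real.exp (-γ * x)| ≤ C * Real.exp (-c * x)) :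
    HasProfileLimit γ p f := by
  refine ⟨⟨Real.exp |γ| * C, c, hc, ?_⟩, ?_⟩
  · filter_upwards [tendsto_sqrt_natCast_atTop.eventually_ge_atTop 1, eventually_gt_atTop 0]
      with s h1 hs m
    have hC : 0 ≤ C := by simpa using (abs_nonneg _).trans (hb 0 le_rfl)
    rw [hpf s hs m]
    set y : ℝ := ((m : ℝ) + δ) / √(s : ℝ) with hy
    have hd0 : 0 ≤ (δ : ℝ) / √(s : ℝ) := by positivity
    have hd1 : (δ : ℝ) / √(s : ℝ) ≤ 1 := by
      rw [div_le_one (by linarith)]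
      exact le_trans (by exact_mod_cast hδ) h1
    have hxy : (m : ℝ) / √(s : ℝ) = y - δ / √(s : ℝ) := by rw [hy]; ring
    have hy0 : 0 ≤ y := by positivity
    have e1 : Real.exp (-γ * (m / √(s : ℝ))) * f y =
        Real.exp (γ * (δ / √(s : ℝ))) * (f y * Real.exp (-γ * y)) := by
      rw [hxy, mul_left_comm, mul_comm, ← Real.exp_add]
      congr 2
      ring
    have e2 : Real.exp (γ * (δ / √(s : ℝ))) ≤ Real.exp |γ| := by
      apply Real.exp_le_exp.2
      nlinarith [le_abs_self γ, abs_nonneg γ]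
    have e3 : C * Real.exp (-c * y) ≤ C * Real.exp (-c * (m / √(s : ℝ))) := by
      refine mul_le_mul_of_nonneg_left (Real.exp_le_exp.2 ?_) hC
      rw [hxy]
      nlinarith
    rw [e1, mul_assoc]
    have h4 : f y * Real.exp (-γ * y) ≤ C * Real.exp (-c * (m / √(s : ℝ))) :=
      (le_abs_self _).trans ((hb y hy0).trans e3)
    exact (mul_le_mul_of_nonneg_left h4 (Real.exp_pos _).le).trans
      (mul_le_mul_of_nonneg_right e2 (by positivity))
  · filter_upwards [hf, ae_restrict_mem measurableSet_Ioi] with x hx hx0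
    have h1 : Tendsto (fun s : ℕ => ((⌊x * √(s : ℝ)⌋₊ : ℝ) + δ) / √(s : ℝ)) atTop (𝓝 x) := by
      simpa [add_mul, div_eq_mul_inv] using
        (tendsto_floor_mul_sqrt_div (le_of_lt hx0)).add (tendsto_inv_sqrt_natCast.const_mul (δ : ℝ))
    refine (hx.tendsto.comp h1).congr' ?_
    filter_upwards [eventually_gt_atTop 0] with s hs
    exact (hpf s hs _).symm

/-- The asymptotic bound holds beyond some `X`; on `[0, X]` compactness bounds `g x * exp (c * x)`.
-/
theorem ExponentiallySmall.exists_bound {g : ℝ → ℝ} (hg : ContinuousOn g (Ici 0))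
    (h : ExponentiallySmall g) :
    ∃ C c : ℝ, 0 < c ∧ ∀ x, 0 ≤ x → |g x| ≤ C * Real.exp (-c * x) := by
  obtain ⟨c, hc, hO⟩ := h
  obtain ⟨C₁, hC₁⟩ := hO.bound
  obtain ⟨X, hX⟩ := eventually_atTop.1 hC₁
  have hcont : ContinuousOn (fun x => g x * Real.exp (c * x)) (Icc 0 X) :=
    (hg.mono Icc_subset_Ici_self).mul (by fun_prop)
  obtain ⟨C₂, hC₂⟩ := isCompact_Icc.exists_bound_of_continuousOn hcont
  refine ⟨max C₁ C₂, c, hc, fun x hx => ?_⟩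
  rcases le_total X x with h | h
  · have h1 := hX x h
    rw [Real.norm_eq_abs, Real.norm_eq_abs, Real.abs_exp] at h1
    exact h1.trans (mul_le_mul_of_nonneg_right (le_max_left _ _) (Real.exp_pos _).le)
  · have h1 := hC₂ x ⟨hx, h⟩
    rw [Real.norm_eq_abs, abs_mul, Real.abs_exp] at h1
    rw [neg_mul, Real.exp_neg, ← div_eq_mul_inv, le_div_iff₀ (Real.exp_pos _)]
    exact h1.trans (le_max_right _ _)

theorem ae_restrict_Ioi_ne (η : ℝ) : ∀ᵐ x ∂volume.restrict (Ioi (0 : ℝ)), x ≠ η :=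
  ae_restrict_of_ae (measure_eq_zero_iff_ae_notMem.1 (measure_singleton η))

theorem thresholdProfile_continuousAt {η x : ℝ} (h0 : 0 < x) (hx : x ≠ η) :
    ContinuousAt (thresholdProfile η) x := by
  rcases lt_or_gt_of_ne hx with h | h
  · refine (continuousAt_const (y := (1 : ℝ))).congr ?_
    filter_upwards [Ioo_mem_nhds h0 h] with y hy
    rw [thresholdProfile, indicator_of_mem (mem_Ico.2 ⟨hy.1.le, hy.2⟩)]
  · refine (continuousAt_const (y := (0 : ℝ))).congr ?_
    filter_upwards [Ioi_mem_nhds h] with y hy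
    rw [thresholdProfile, indicator_of_notMem fun hy' => (hy'.2.trans hy).false]

theorem thresholdProfile_bound (γ η x : ℝ) (hx : 0 ≤ x) :
    |thresholdProfile η x * Real.exp (-γ * x)| ≤
      Real.exp ((|γ| + 1) * |η|) * Real.exp (-1 * x) := by
  by_cases h : x ∈ Ico 0 η
  · rw [thresholdProfile, indicator_of_mem h, one_mul, Real.abs_exp, ← Real.exp_add]
    apply Real.exp_le_exp.2
    have h1 : x ≤ |η| := h.2.le.trans (le_abs_self η)
    nlinarith [neg_abs_le γ, abs_nonneg γ]
  · rw [thresholdProfile, indicator_of_notMem h, zero_mul, abs_zero]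
    positivity

theorem thresholdControl_isAdmissionControl (η : ℝ) : IsAdmissionControl (thresholdControl η) := by
  intro s m
  unfold thresholdControl
  split_ifs <;> simp

theorem prod_thresholdControl (η : ℝ) (s m : ℕ) :
    ∏ i ∈ Finset.range (m + 1), thresholdControl η s i = thresholdControl η s m := by
  by_cases h : m ≤ ⌊η * √(s : ℝ)⌋₊
  · rw [thresholdControl, if_pos h]
    exact Finset.prod_eq_one fun i hi =>
      if_pos ((Nat.lt_succ_iff.1 (Finset.mem_range.1 hi)).trans h)
  · have h0 : thresholdControl η s m = 0 := if_neg h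
    rw [h0]
    exact Finset.prod_eq_zero (Finset.self_mem_range_succ m) h0

/-- The product of these indicators is again an indicator, and at `⌊x √s⌋` it is eventually constant
in `s` unless `x = η`, a null set. -/
theorem thresholdControl_hasProfileLimit (γ : ℝ) {η : ℝ} (hη : 0 ≤ η) :
    HasProfileLimit γ (thresholdControl η) (thresholdProfile η) := by
  refine ⟨⟨Real.exp ((|γ| + 1) * η), 1, one_pos, ?_⟩, ?_⟩
  · filter_upwards [eventually_gt_atTop 0] with s hs m
    have hs' : 0 < √(s : ℝ) := Real.sqrt_pos.2 (by exact_mod_cast hs)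
    rw [prod_thresholdControl, thresholdControl]
    split_ifs with h
    · have h1 : (m : ℝ) / √(s : ℝ) ≤ η := by
        rw [div_le_iff₀ hs']
        exact (Nat.le_floor_iff (by positivity)).1 h
      have h0 : 0 ≤ (m : ℝ) / √(s : ℝ) := by positivity
      rw [mul_one, ← Real.exp_add]
      apply Real.exp_le_exp.2
      nlinarith [neg_abs_le γ, abs_nonneg γ]
    · rw [mul_zero]
      positivity
  · filter_upwards [ae_restrict_Ioi_ne η, ae_restrict_mem measurableSet_Ioi] with x hx hx0
    simp only [prod_thresholdControl]
    rcases lt_or_gt_of_ne hx with h | h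
    · rw [thresholdProfile, indicator_of_mem (mem_Ico.2 ⟨le_of_lt hx0, h⟩)]
      refine tendsto_const_nhds.congr fun s => (if_pos ?_).symm
      exact Nat.floor_le_floor (mul_le_mul_of_nonneg_right h.le (Real.sqrt_nonneg _))
    · rw [thresholdProfile, indicator_of_notMem fun hx' => (hx'.2.trans h).false]
      refine tendsto_const_nhds.congr' ?_
      -- Once `(x - η) * √s > 1`, the floor of `x √s` lies strictly above `η √s`.
      filter_upwards [(tendsto_sqrt_natCast_atTop.const_mul_atTop
        (sub_pos.2 h)).eventually_gt_atTop 1] with s hs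
      refine (if_neg (not_le.2 ?_)).symm
      rw [Nat.floor_lt (by positivity)]
      have := Nat.lt_floor_add_one (x * √(s : ℝ))
      linarith

theorem integral_Ici_mul_thresholdProfile (γ : ℝ) (g : ℝ → ℝ) {η : ℝ} (hη : 0 ≤ η) :
    ∫ x in Ici (0 : ℝ), g x * thresholdProfile η x * Real.exp (-γ * x) =
      ∫ x in (0 : ℝ)..η, g x * Real.exp (-γ * x) := by
  have h : (fun x => g x * thresholdProfile η x * Real.exp (-γ * x)) =
      (Ico 0 η).indicator fun x => g x * Real.exp (-γ * x) := by
    ext x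
    by_cases hx : x ∈ Ico 0 η <;> simp [thresholdProfile, hx]
  rw [h, setIntegral_indicator measurableSet_Ico, intervalIntegral.integral_of_le hη,
    inter_eq_self_of_subset_right Ico_subset_Ici_self, integral_Ico_eq_integral_Ioo,
    integral_Ioc_eq_integral_Ioo]

theorem intervalIntegral_exp_neg_mul (γ η : ℝ) : ∫ x in (0 : ℝ)..η, Real.exp (-γ * x) =
    if γ = 0 then η else (1 - Real.exp (-γ * η)) / γ := by
  split_ifs with h
  · simp [h]
  · rw [intervalIntegral.integral_comp_mul_left _ (neg_ne_zero.2 h), integral_exp]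
    simp
    field_simp
    ring

theorem limitRevenue_thresholdProfile (γ : ℝ) (r : ℝ → ℝ) {η : ℝ} (hη : 0 ≤ η) :
    limitRevenue γ r (thresholdProfile η) = thresholdRevenue γ r η := by
  have h := integral_Ici_mul_thresholdProfile γ (fun _ => 1) hη
  simp only [one_mul] at h
  rw [limitRevenue, thresholdRevenue, integral_Ici_mul_thresholdProfile γ r hη, h,
    intervalIntegral_exp_neg_mul]

/-! ### The main theorem -/

theorem BoundedC2On.continuousOn {r : ℝ → ℝ} {S : Set ℝ} (h : BoundedC2On r S) :
    ContinuousOn r S := h.1.continuousOn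

theorem BoundedC2On.exists_bound {r : ℝ → ℝ} {S : Set ℝ} (h : BoundedC2On r S) :
    ∃ C, ∀ x ∈ S, |r x| ≤ C := by
  obtain ⟨C, hC⟩ := h.2
  exact ⟨C, fun x hx => by simpa using hC 0 (by norm_num) x hx⟩

theorem mainTheorem1 (γ : ℝ) (r : ℝ → ℝ) (rs : ℕ → ℕ → ℝ) (n q : ℕ → ℝ)
    (hq : ∀ s, 0 < s → q s ≠ 0)
    (hrL : BoundedC2On r (Iic 0)) (hrR : BoundedC2On r (Ici 0))
    (hrs : RevenueScaling rs n q r) :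
    IntegrableOn (fun x => r x * Real.exp (-x ^ 2 / 2 - γ * x)) (Iio 0) ∧
    -- smooth profiles
    (∀ (f : ℝ → ℝ) (δ : ℕ) (p : ℕ → ℕ → ℝ), δ ≤ 1 →
      ContDiffOn ℝ 2 f (Ici 0) →
      (∀ i ≤ 2, ExponentiallySmall
        (iteratedDerivWithin i (fun x => f x * Real.exp (-γ * x)) (Ici 0))) →
      IsAdmissionControl p → AdmissionScaling δ p f →
      IntegrableOn (fun x => r x * f x * Real.exp (-γ * x)) (Ici 0) ∧
      IntegrableOn (fun x => f x * Real.exp (-γ * x)) (Ici 0) ∧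
      HasRevenueLimit γ rs n q p (limitRevenue γ r f)) ∧
    -- threshold profiles
    (∀ η : ℝ, 0 ≤ η →
      limitRevenue γ r (thresholdProfile η) = thresholdRevenue γ r η ∧
      (∀ (δ : ℕ) (p : ℕ → ℕ → ℝ), δ ≤ 1 →
        IsAdmissionControl p → AdmissionScaling δ p (thresholdProfile η) →
        HasRevenueLimit γ rs n q p (thresholdRevenue γ r η)) ∧
      HasRevenueLimit γ rs n q (thresholdControl η) (thresholdRevenue γ r η)) := by
  -- The two closed half-lines overlap at `0`, so continuity on each glues to continuity on the
  -- line, kink included.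
  have hr : Continuous r := by
    rw [← continuousOn_univ, ← Iic_union_Ici (a := (0 : ℝ))]
    exact hrL.continuousOn.union_of_isClosed hrR.continuousOn isClosed_Iic isClosed_Ici
  obtain ⟨K, hK⟩ : ∃ K, ∀ x, |r x| ≤ K := by
    obtain ⟨K₁, h₁⟩ := hrL.exists_bound
    obtain ⟨K₂, h₂⟩ := hrR.exists_bound
    refine ⟨max K₁ K₂, fun x => ?_⟩
    rcases le_total x 0 with hx | hx
    · exact (h₁ x hx).trans (le_max_left _ _)
    · exact (h₂ x hx).trans (le_max_right _ _)
  refine ⟨(tendsto_left_sum γ hr hK).1, fun f δ p hδ hf hexp hp hpf => ?_, fun η hη => ?_⟩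
  · have h0 := hexp 0 (by norm_num)
    rw [iteratedDerivWithin_zero] at h0
    obtain ⟨C, c, hc, hb⟩ := h0.exists_bound (hf.continuousOn.mul (by fun_prop))
    have hcont : ∀ᵐ x ∂volume.restrict (Ioi (0 : ℝ)), ContinuousAt f x := by
      filter_upwards [ae_restrict_mem measurableSet_Ioi] with x hx
      exact hf.continuousOn.continuousAt (Ici_mem_nhds hx)
    have h := hpf.hasProfileLimit hδ hcont hc hb
    refine ⟨(tendsto_right_sum hp h hr hK).1, ?_,
      hasRevenueLimit_of_profileLimit hq hr hK hrs hp h⟩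
    simpa using (tendsto_right_sum hp h (g := fun _ => 1) continuous_const (K := 1) (by simp)).1
  · rw [← limitRevenue_thresholdProfile γ r hη]
    refine ⟨rfl, fun δ p hδ hp hpf => hasRevenueLimit_of_profileLimit hq hr hK hrs hp
      (hpf.hasProfileLimit hδ ?_ one_pos (thresholdProfile_bound γ η)),
      hasRevenueLimit_of_profileLimit hq hr hK hrs (thresholdControl_isAdmissionControl η)
        (thresholdControl_hasProfileLimit γ hη)⟩
    filter_upwards [ae_restrict_Ioi_ne η, ae_restrict_mem measurableSet_Ioi] with x h1 h2
    exact thresholdProfile_continuousAt h2 h1
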